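/- Let $\omega=e^{\pi i/4}$ and $$X=\begin{bmatrix}0&1\\1&0\end{bmatrix},\quad Z=\begin{bmatrix}1&0\\0&-1\end{bmatrix},\quad H=\tfrac1{\sqrt2}\begin{bmatrix}1&1\\1&-1\end{bmatrix},\quad S=\begin{bmatrix}1&0\\0&\omega^2\end{bmatrix},\quad CZ=\mathrm{diag}(1,1,1,-1).$$ For $n\ge 1$ and a $2\times2$ matrix $U$ put $U_i=I_2^{\otimes(i-1)}\otimes U\otimes I_2^{\otimes(n-i)}$ $(1\le i\le n)$ and $CZ_{i\to i+1}=I_2^{\otimes(i-1)}\otimes CZ\otimes I_2^{\otimes(n-i-1)}$ $(1\le i\le n-1)$. Let $\mathrm{Pauli}_n=\langle X_1,\dots,X_n,Z_1,\dots,Z_n,\omega^2I\rangle$, let $\mathrm{Cliff}_n$ be its normalizer in the unitary group $U(2^n)$, and let $\mathcal C_n=\mathrm{Cliff}_n/\langle\omega I\rangle$, where products in $\mathcal C_n$ are written from left to right (the opposite of the order of matrix multiplication). Let $h_i,s_i,\Lambda_i\in\mathcal C_n$ be the classes of $H_i,S_i,CZ_{i\to i+1}$, and for $n\ge2$ let $M=h_2\Lambda_1s_2^2h_2h_1s_1^2h_2\Lambda_1h_2$.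 Define the subgroups $\mathcal{IN}_n$ and $F_n$ of $\mathcal C_n$ by $$\mathcal{IN}_n=\begin{cases}\langle h_1,\ s_1^3h_1s_1h_1s_1\rangle,&n=1,\\ \langle h_1,h_2,s_2,h_1s_1^2h_1,M\rangle,&n=2,\\ \langle h_1,\dots,h_n,\ s_2,\dots,s_n,\ M,\ \Lambda_2,\dots,\Lambda_{n-1}\rangle,&n\ge3,\end{cases}$$ $$F_n=\begin{cases}\langle s_1^3h_1s_1h_1s_1\rangle,&n=1,\\ \langle h_2,s_2,h_1s_1^2h_1,M\rangle,&n=2,\\ \langle h_2,\dots,h_n,\ s_2,\dots,s_n,\ M,\ \Lambda_2,\dots,\Lambda_{n-1}\rangle,&n\ge3.\end{cases}$$ Then, for every $n\ge1$, the group $\mathcal{IN}_n$ is finite and $F_n$ is a normal subgroup of $\mathcal{IN}_n$ of order $|\mathcal{IN}_n|/2$. -/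

import Mathlib

open scoped Matrix

namespace QubitClifford

noncomputable section

/-- The primitive eighth root of unity `ω = exp (π i / 4)`; thus `ω ^ 2 = i`. -/
def omega : ℂ := Complex.exp (Real.pi * Complex.I / 4)

theorem omega_sq : omega ^ 2 = Complex.I := by
  have h : ((2 : ℕ) : ℂ) * (Real.pi * Complex.I / 4) = Real.pi / 2 * Complex.I := by
    push_cast
    ring
  rw [omega, ← Complex.exp_nat_mul, h, Complex.exp_pi_div_two_mul_I]

theorem star_omega_mul : star omega * omega = 1 := by
  have h : star omega = Complex.exp (-(Real.pi * Complex.I / 4)) := by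
    rw [omega, Complex.star_def, ← Complex.exp_conj]
    congr 1
    have h4 : (starRingEnd ℂ) 4 = 4 := Complex.conj_ofNat 4
    simp [neg_div, h4]
  rw [h, omega, ← Complex.exp_add]
  simp

/-! ### One- and two-qubit gates -/

/-- The group of `2 × 2` unitary matrices. -/
abbrev U2 := Matrix.unitaryGroup (Fin 2) ℂ

/-- The unitary group `U(2 ^ n)`; the computational basis of `n` qubits is indexed by the bit
strings `Fin n → Fin 2`. -/
abbrev UN (n : ℕ) := Matrix.unitaryGroup (Fin n → Fin 2) ℂ

def matX : Matrix (Fin 2) (Fin 2) ℂ := !![0, 1; 1, 0]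

def matZ : Matrix (Fin 2) (Fin 2) ℂ := !![1, 0; 0, -1]

def matH : Matrix (Fin 2) (Fin 2) ℂ := ((1 / Real.sqrt 2 : ℝ) : ℂ) • !![1, 1; 1, -1]

def matS : Matrix (Fin 2) (Fin 2) ℂ := !![1, 0; 0, omega ^ 2]

/-- The controlled `Z` gate; the basis of two qubits is indexed by pairs of bits. -/
def matCZ : Matrix (Fin 2 × Fin 2) (Fin 2 × Fin 2) ℂ :=
  Matrix.diagonal fun p => if p = (1, 1) then -1 else 1

theorem sqrt_two_inv_sq : ((1 / Real.sqrt 2 : ℝ) : ℂ) * ((1 / Real.sqrt 2 : ℝ) : ℂ) = 1 / 2 := by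
  rw [← Complex.ofReal_mul]
  have h : (1 / Real.sqrt 2) * (1 / Real.sqrt 2) = (1 / 2 : ℝ) := by
    rw [div_mul_div_comm, Real.mul_self_sqrt (by norm_num)]
    norm_num
  rw [h]
  norm_num

theorem matH_mul_self : matH * matH = 1 := by
  rw [matH, Matrix.smul_mul, Matrix.mul_smul, smul_smul, sqrt_two_inv_sq]
  ext a b
  fin_cases a <;> fin_cases b <;> norm_num [Matrix.mul_apply, Fin.sum_univ_two]

theorem star_matH : star matH = matH := by
  ext a b
  fin_cases a <;> fin_cases b <;> simp [matH, Matrix.star_apply]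

def gX : U2 := ⟨matX, by
  rw [Matrix.mem_unitaryGroup_iff]
  ext a b
  fin_cases a <;> fin_cases b <;> simp [matX, Matrix.mul_apply, Fin.sum_univ_two]⟩

def gZ : U2 := ⟨matZ, by
  rw [Matrix.mem_unitaryGroup_iff]
  ext a b
  fin_cases a <;> fin_cases b <;> simp [matZ, Matrix.mul_apply, Fin.sum_univ_two]⟩

def gH : U2 := ⟨matH, by
  rw [Matrix.mem_unitaryGroup_iff, star_matH, matH_mul_self]⟩

def gS : U2 := ⟨matS, by
  rw [Matrix.mem_unitaryGroup_iff]
  ext a b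
  fin_cases a <;> fin_cases b <;> simp [matS, omega_sq, Matrix.mul_apply, Fin.sum_univ_two]⟩

/-- The tensor (Kronecker) product `A 0 ⊗ A 1 ⊗ ⋯ ⊗ A (n - 1)` of `2 × 2` matrices. -/
def tensor {n : ℕ} (A : Fin n → Matrix (Fin 2) (Fin 2) ℂ) :
    Matrix (Fin n → Fin 2) (Fin n → Fin 2) ℂ :=
  Matrix.of fun x y => ∏ j, A j (x j) (y j)

theorem tensor_mul {n : ℕ} (A B : Fin n → Matrix (Fin 2) (Fin 2) ℂ) :
    tensor A * tensor B = tensor (fun j => A j * B j) := by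
  ext x y
  simp only [tensor, Matrix.mul_apply, Matrix.of_apply, Finset.prod_univ_sum,
    Fintype.piFinset_univ, Finset.prod_mul_distrib]

theorem tensor_one {n : ℕ} :
    tensor (fun _ : Fin n => (1 : Matrix (Fin 2) (Fin 2) ℂ)) = 1 := by
  ext x y
  by_cases h : x = y
  · subst h
    simp [tensor]
  · obtain ⟨j, hj⟩ := Function.ne_iff.1 h
    rw [Matrix.one_apply_ne h, tensor, Matrix.of_apply]
    exact Finset.prod_eq_zero (Finset.mem_univ j) (Matrix.one_apply_ne hj)

theorem star_tensor {n : ℕ} (A : Fin n → Matrix (Fin 2) (Fin 2) ℂ) :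
    star (tensor A) = tensor (fun j => star (A j)) := by
  ext x y
  simp [tensor, Matrix.star_apply]

/-- The tensor product of unitary matrices, as a group homomorphism. -/
def tensorHom (n : ℕ) : (Fin n → U2) →* UN n where
  toFun A := ⟨tensor fun j => (A j : Matrix (Fin 2) (Fin 2) ℂ), by
    rw [Matrix.mem_unitaryGroup_iff, star_tensor, tensor_mul, ← tensor_one]
    congr 1
    funext j
    exact Matrix.mem_unitaryGroup_iff.1 (A j).2⟩
  map_one' := Subtype.ext tensor_one
  map_mul' A B := Subtype.ext (tensor_mul _ _).symm

/-- `U_i = I ⊗ ⋯ ⊗ I ⊗ U ⊗ I ⊗ ⋯ ⊗ I`, the gate `U` acting on the qubit `i`. -/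
def onQubit {n : ℕ} (U : U2) (i : Fin n) : UN n := tensorHom n (Pi.mulSingle i U)

/-- `I ⊗ ⋯ ⊗ I ⊗ G ⊗ I ⊗ ⋯ ⊗ I`, with the `4 × 4` matrix `G` acting on the qubits `i`, `i + 1`. -/
def onPair {k : ℕ} (G : Matrix (Fin 2 × Fin 2) (Fin 2 × Fin 2) ℂ) (i : Fin k) :
    Matrix (Fin (k + 1) → Fin 2) (Fin (k + 1) → Fin 2) ℂ :=
  Matrix.of fun x y =>
    G (x i.castSucc, x i.succ) (y i.castSucc, y i.succ) *
      ∏ j ∈ Finset.univ \ {i.castSucc, i.succ}, (1 : Matrix (Fin 2) (Fin 2) ℂ) (x j) (y j)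

/-- The diagonal entries of the controlled `Z` gate on the qubits `i`, `i + 1`. -/
def czSign {k : ℕ} (i : Fin k) (x : Fin (k + 1) → Fin 2) : ℂ :=
  if (x i.castSucc, x i.succ) = (1, 1) then -1 else 1

theorem onPair_matCZ {k : ℕ} (i : Fin k) : onPair matCZ i = Matrix.diagonal (czSign i) := by
  ext x y
  by_cases h : x = y
  · subst h
    simp [onPair, matCZ, czSign]
  · rw [Matrix.diagonal_apply_ne _ h, onPair, Matrix.of_apply]
    obtain ⟨j, hj⟩ := Function.ne_iff.1 h
    by_cases hm : j ∈ Finset.univ \ {i.castSucc, i.succ}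
    · exact mul_eq_zero_of_right _ (Finset.prod_eq_zero hm (Matrix.one_apply_ne hj))
    · have h2 : (x i.castSucc, x i.succ) ≠ (y i.castSucc, y i.succ) := by
        intro he
        simp only [Prod.mk.injEq] at he
        simp only [Finset.mem_sdiff, Finset.mem_univ, true_and, Finset.mem_insert,
          Finset.mem_singleton, not_not] at hm
        rcases hm with rfl | rfl
        · exact hj he.1
        · exact hj he.2
      rw [matCZ, Matrix.diagonal_apply_ne _ h2, zero_mul]

theorem czSign_mul_self {k : ℕ} (i : Fin k) (x : Fin (k + 1) → Fin 2) :
    czSign i x * czSign i x = 1 := by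
  unfold czSign
  split_ifs <;> norm_num

/-- The controlled `Z` gate on the qubits `i`, `i + 1`. -/
def uCZ {k : ℕ} (i : Fin k) : UN (k + 1) := ⟨onPair matCZ i, by
  rw [Matrix.mem_unitaryGroup_iff, onPair_matCZ, Matrix.star_eq_conjTranspose,
    Matrix.diagonal_conjTranspose, Matrix.diagonal_mul_diagonal, ← Matrix.diagonal_one]
  congr 1
  funext x
  have h : star (czSign i) x = czSign i x := by
    simp only [Pi.star_apply, czSign]
    split_ifs <;> simp
  rw [h, czSign_mul_self]⟩

/-- The scalar matrix `ω I`. -/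
def omegaI (n : ℕ) : UN n := ⟨omega • 1, by
  rw [Matrix.mem_unitaryGroup_iff', star_smul, star_one, Matrix.smul_mul, Matrix.one_mul,
    smul_smul, star_omega_mul, one_smul]⟩

theorem omegaI_comm {n : ℕ} (U : UN n) : U * omegaI n = omegaI n * U := by
  apply Subtype.ext
  simp [omegaI]

/-! ### Pauli and Clifford groups -/

/-- The `n`-qubit Pauli group. -/
def Pauli (n : ℕ) : Subgroup (UN n) :=
  Subgroup.closure
    (Set.range (fun i : Fin n => onQubit gX i) ∪ Set.range (fun i : Fin n => onQubit gZ i) ∪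
      {omegaI n ^ 2})

/-- The `n`-qubit Clifford group: the normalizer of the Pauli group in the unitary group. -/
def Cliff (n : ℕ) : Subgroup (UN n) := Subgroup.normalizer (Pauli n : Set (UN n))

theorem onQubit_gX_mem {n : ℕ} (i : Fin n) : onQubit gX i ∈ Pauli n :=
  Subgroup.subset_closure (Or.inl (Or.inl ⟨i, rfl⟩))

theorem onQubit_gZ_mem {n : ℕ} (i : Fin n) : onQubit gZ i ∈ Pauli n :=
  Subgroup.subset_closure (Or.inl (Or.inr ⟨i, rfl⟩))

theorem omegaI_sq_mem (n : ℕ) : omegaI n ^ 2 ∈ Pauli n :=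
  Subgroup.subset_closure (Or.inr rfl)

theorem conj_mem_Pauli {n : ℕ} {U : UN n}
    (hX : ∀ i, U * onQubit gX i * U⁻¹ ∈ Pauli n) (hZ : ∀ i, U * onQubit gZ i * U⁻¹ ∈ Pauli n)
    {P : UN n} (hP : P ∈ Pauli n) : U * P * U⁻¹ ∈ Pauli n := by
  have h : Pauli n ≤ (Pauli n).comap (MulAut.conj U).toMonoidHom := by
    conv_lhs => rw [Pauli]
    rw [Subgroup.closure_le]
    rintro P ((⟨i, rfl⟩ | ⟨i, rfl⟩) | rfl)
    · simpa using hX i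
    · simpa using hZ i
    · have hc : Commute U (omegaI n ^ 2) := Commute.pow_right (omegaI_comm U) 2
      have he : U * omegaI n ^ 2 * U⁻¹ = omegaI n ^ 2 := by rw [hc.eq, mul_inv_cancel_right]
      simpa [he] using omegaI_sq_mem n
  simpa using h hP

theorem mem_Cliff_of_conj {n : ℕ} {U : UN n} {m : ℕ} (hm : U ^ (m + 1) = 1)
    (hX : ∀ i, U * onQubit gX i * U⁻¹ ∈ Pauli n)
    (hZ : ∀ i, U * onQubit gZ i * U⁻¹ ∈ Pauli n) : U ∈ Cliff n := by
  have hpow : ∀ (r : ℕ) (P : UN n), P ∈ Pauli n → U ^ r * P * (U ^ r)⁻¹ ∈ Pauli n := by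
    intro r
    induction r with
    | zero => intro P hP; simpa using hP
    | succ r ih =>
      intro P hP
      have h := conj_mem_Pauli hX hZ (ih P hP)
      have he : U ^ (r + 1) * P * (U ^ (r + 1))⁻¹ = U * (U ^ r * P * (U ^ r)⁻¹) * U⁻¹ := by
        rw [pow_succ']
        group
      rwa [he]
  rw [Cliff, Subgroup.mem_normalizer_iff]
  intro P
  refine ⟨fun hP => conj_mem_Pauli hX hZ hP, fun hP => ?_⟩
  have h := hpow m _ hP
  have he : U ^ m * (U * P * U⁻¹) * (U ^ m)⁻¹ = U ^ (m + 1) * P * (U ^ (m + 1))⁻¹ := by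
    rw [pow_succ]
    group
  rw [he, hm] at h
  simpa using h

theorem onQubit_mul {n : ℕ} (U V : U2) (i : Fin n) :
    onQubit U i * onQubit V i = onQubit (U * V) i := by
  simp only [onQubit, ← map_mul, Pi.mulSingle_mul]

theorem onQubit_one {n : ℕ} (i : Fin n) : onQubit 1 i = (1 : UN n) := by
  simp [onQubit]

theorem onQubit_inv {n : ℕ} (U : U2) (i : Fin n) : (onQubit U i)⁻¹ = onQubit U⁻¹ i := by
  rw [inv_eq_iff_mul_eq_one, onQubit_mul, mul_inv_cancel, onQubit_one]

theorem onQubit_pow {n : ℕ} (U : U2) (i : Fin n) (m : ℕ) :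
    onQubit U i ^ m = onQubit (U ^ m) i := by
  induction m with
  | zero => simp [onQubit_one]
  | succ m ih => rw [pow_succ, pow_succ, ih, onQubit_mul]

theorem onQubit_commute {n : ℕ} (U V : U2) {i j : Fin n} (h : i ≠ j) :
    onQubit U i * onQubit V j = onQubit V j * onQubit U i := by
  simp only [onQubit, ← map_mul]
  exact congrArg _ (Pi.mulSingle_commute (f := fun _ : Fin n => U2) h U V).eq

theorem onQubit_conj {n : ℕ} (U V : U2) (i j : Fin n) :
    onQubit U i * onQubit V j * (onQubit U i)⁻¹ =
      if i = j then onQubit (U * V * U⁻¹) j else onQubit V j := by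
  split_ifs with h
  · subst h
    rw [onQubit_inv, onQubit_mul, onQubit_mul]
  · rw [onQubit_commute U V h, mul_inv_cancel_right]

theorem gH_sq : gH ^ 2 = 1 := by
  rw [pow_two]
  exact Subtype.ext matH_mul_self

theorem gH_conj_gX : gH * gX * gH⁻¹ = gZ := by
  rw [mul_inv_eq_iff_eq_mul]
  apply Subtype.ext
  ext a b
  fin_cases a <;> fin_cases b <;>
    simp [gH, gX, gZ, matH, matX, matZ]

theorem gH_conj_gZ : gH * gZ * gH⁻¹ = gX := by
  rw [mul_inv_eq_iff_eq_mul]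
  apply Subtype.ext
  ext a b
  fin_cases a <;> fin_cases b <;>
    simp [gH, gX, gZ, matH, matX, matZ]

theorem gS_pow : gS ^ 4 = 1 := by
  apply Subtype.ext
  change matS ^ 4 = 1
  ext a b
  rw [matS, omega_sq]
  fin_cases a <;> fin_cases b <;> simp [pow_succ]

theorem gS_conj_gZ : gS * gZ * gS⁻¹ = gZ := by
  rw [mul_inv_eq_iff_eq_mul]
  apply Subtype.ext
  ext a b
  fin_cases a <;> fin_cases b <;>
    simp [gS, gZ, matS, matZ]

theorem onQubit_gS_conj_gX {n : ℕ} (i : Fin n) :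
    onQubit (gS * gX * gS⁻¹) i = omegaI n ^ 2 * (onQubit gX i * onQubit gZ i) := by
  rw [onQubit_mul]
  apply Subtype.ext
  ext x y
  have h1 : ((omegaI n ^ 2 * onQubit (gX * gZ) i : UN n) : Matrix _ _ ℂ) x y =
      Complex.I * ((onQubit (gX * gZ) i : UN n) : Matrix _ _ ℂ) x y := by
    simp [omegaI, pow_two, ← omega_sq, mul_assoc]
  rw [h1]
  simp only [onQubit, tensorHom, tensor, MonoidHom.coe_mk, OneHom.coe_mk, Matrix.of_apply]
  rw [← Finset.mul_prod_erase _ _ (Finset.mem_univ i),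
    ← Finset.mul_prod_erase (a := i) (f := fun j =>
      ((Pi.mulSingle i (gX * gZ) : Fin n → U2) j : Matrix (Fin 2) (Fin 2) ℂ) (x j) (y j))
      _ (Finset.mem_univ i), ← mul_assoc]
  congr 1
  · have h2 : ((gS * gX * gS⁻¹ : U2) : Matrix (Fin 2) (Fin 2) ℂ) =
        Complex.I • ((gX * gZ : U2) : Matrix (Fin 2) (Fin 2) ℂ) := by
      ext a b
      fin_cases a <;> fin_cases b <;>
        simp [gS, gX, gZ, matS, matX, matZ, omega_sq, Matrix.mul_apply, Fin.sum_univ_two,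
          Matrix.star_apply]
    simp only [Pi.mulSingle_eq_same]
    rw [h2]
    rfl
  · refine Finset.prod_congr rfl fun j hj => ?_
    have hne : j ≠ i := Finset.ne_of_mem_erase hj
    rw [Pi.mulSingle_eq_of_ne hne, Pi.mulSingle_eq_of_ne hne]

theorem onQubit_gH_mem {n : ℕ} (i : Fin n) : onQubit gH i ∈ Cliff n := by
  refine mem_Cliff_of_conj (m := 1) ?_ (fun j => ?_) (fun j => ?_)
  · rw [onQubit_pow, gH_sq, onQubit_one]
  · rw [onQubit_conj, gH_conj_gX]
    split_ifs
    exacts [onQubit_gZ_mem j, onQubit_gX_mem j]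
  · rw [onQubit_conj, gH_conj_gZ]
    split_ifs
    exacts [onQubit_gX_mem j, onQubit_gZ_mem j]

theorem onQubit_gS_mem {n : ℕ} (i : Fin n) : onQubit gS i ∈ Cliff n := by
  refine mem_Cliff_of_conj (m := 3) ?_ (fun j => ?_) (fun j => ?_)
  · rw [onQubit_pow, gS_pow, onQubit_one]
  · rw [onQubit_conj, onQubit_gS_conj_gX]
    split_ifs
    · exact mul_mem (omegaI_sq_mem n) (mul_mem (onQubit_gX_mem j) (onQubit_gZ_mem j))
    · exact onQubit_gX_mem j
  · rw [onQubit_conj, gS_conj_gZ]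
    split_ifs <;> exact onQubit_gZ_mem j

theorem uCZ_mul_self {k : ℕ} (i : Fin k) : uCZ i * uCZ i = 1 := by
  apply Subtype.ext
  change onPair matCZ i * onPair matCZ i = 1
  rw [onPair_matCZ, Matrix.diagonal_mul_diagonal, ← Matrix.diagonal_one]
  congr 1
  funext x
  exact czSign_mul_self i x

theorem uCZ_mul_apply {k : ℕ} (i : Fin k) (U : UN (k + 1)) (x y : Fin (k + 1) → Fin 2) :
    ((uCZ i * U : UN (k + 1)) : Matrix _ _ ℂ) x y = czSign i x * (U : Matrix _ _ ℂ) x y := by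
  change (onPair matCZ i * (U : Matrix (Fin (k + 1) → Fin 2) (Fin (k + 1) → Fin 2) ℂ) : Matrix (Fin (k + 1) → Fin 2) (Fin (k + 1) → Fin 2) ℂ) x y = _
  rw [onPair_matCZ, Matrix.diagonal_mul]

theorem mul_uCZ_apply {k : ℕ} (i : Fin k) (U : UN (k + 1)) (x y : Fin (k + 1) → Fin 2) :
    ((U * uCZ i : UN (k + 1)) : Matrix _ _ ℂ) x y = (U : Matrix _ _ ℂ) x y * czSign i y := by
  change ((U : Matrix (Fin (k + 1) → Fin 2) (Fin (k + 1) → Fin 2) ℂ) * onPair matCZ i : Matrix (Fin (k + 1) → Fin 2) (Fin (k + 1) → Fin 2) ℂ) x y = _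
  rw [onPair_matCZ, Matrix.mul_diagonal]

theorem onQubit_apply {n : ℕ} (U : U2) (i : Fin n) (x y : Fin n → Fin 2) :
    ((onQubit U i : UN n) : Matrix _ _ ℂ) x y =
      (U : Matrix (Fin 2) (Fin 2) ℂ) (x i) (y i) * if ∀ j, j ≠ i → x j = y j then 1 else 0 := by
  simp only [onQubit, tensorHom, tensor, MonoidHom.coe_mk, OneHom.coe_mk, Matrix.of_apply]
  rw [← Finset.mul_prod_erase _ _ (Finset.mem_univ i), Pi.mulSingle_eq_same]
  congr 1
  split_ifs with h
  · refine Finset.prod_eq_one fun j hj => ?_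
    have hne : j ≠ i := Finset.ne_of_mem_erase hj
    rw [Pi.mulSingle_eq_of_ne hne, h j hne]
    simp
  · push Not at h
    obtain ⟨j, hne, hj⟩ := h
    refine Finset.prod_eq_zero (Finset.mem_erase.2 ⟨hne, Finset.mem_univ j⟩) ?_
    rw [Pi.mulSingle_eq_of_ne hne]
    simp [hj]

theorem onQubit_gZ_mul_apply {n : ℕ} (i : Fin n) (U : UN n) (x y : Fin n → Fin 2) :
    ((onQubit gZ i * U : UN n) : Matrix _ _ ℂ) x y =
      (if x i = 1 then -1 else 1) * (U : Matrix _ _ ℂ) x y := by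
  have h : ((onQubit gZ i : UN n) : Matrix _ _ ℂ) =
      Matrix.diagonal fun x : Fin n → Fin 2 => if x i = 1 then (-1 : ℂ) else 1 := by
    ext x y
    rw [onQubit_apply]
    by_cases hxy : x = y
    · subst hxy
      rw [Matrix.diagonal_apply_eq]
      generalize x i = a
      fin_cases a <;> simp [gZ, matZ]
    · rw [Matrix.diagonal_apply_ne _ hxy]
      split_ifs with hj
      · have hi : x i ≠ y i := by
          intro hi
          apply hxy
          funext j
          by_cases hji : j = i
          · rw [hji, hi]
          · exact hj j hji
        generalize x i = a at hi
        generalize y i = b at hi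
        fin_cases a <;> fin_cases b <;> simp [gZ, matZ] at hi ⊢
      · simp
  change (((onQubit gZ i : UN n) : Matrix (Fin n → Fin 2) (Fin n → Fin 2) ℂ) * (U : Matrix (Fin n → Fin 2) (Fin n → Fin 2) ℂ) :
    Matrix (Fin n → Fin 2) (Fin n → Fin 2) ℂ) x y = _
  rw [h, Matrix.diagonal_mul]

theorem uCZ_conj_gZ {k : ℕ} (i : Fin k) (j : Fin (k + 1)) :
    uCZ i * onQubit gZ j * (uCZ i)⁻¹ = onQubit gZ j := by
  rw [mul_inv_eq_iff_eq_mul]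
  apply Subtype.ext
  ext x y
  rw [uCZ_mul_apply, onQubit_gZ_mul_apply, ← mul_one (onQubit gZ j), onQubit_gZ_mul_apply]
  by_cases h : x = y
  · subst h
    change _ = _ * (onPair matCZ i) x x
    rw [onPair_matCZ, Matrix.diagonal_apply_eq]
    simp [mul_comm]
  · change _ = _ * (onPair matCZ i) x y
    rw [onPair_matCZ, Matrix.diagonal_apply_ne _ h]
    simp [Matrix.one_apply_ne h]

theorem uCZ_conj_gX {k : ℕ} (i : Fin k) (j : Fin (k + 1)) :
    uCZ i * onQubit gX j * (uCZ i)⁻¹ =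
      if j = i.castSucc then onQubit gZ i.succ * onQubit gX j
      else if j = i.succ then onQubit gZ i.castSucc * onQubit gX j else onQubit gX j := by
  have hne : i.castSucc ≠ i.succ := (Fin.castSucc_lt_succ (i := i)).ne
  rw [mul_inv_eq_iff_eq_mul]
  apply Subtype.ext
  ext x y
  rw [uCZ_mul_apply, mul_uCZ_apply]
  have hX : ((onQubit gX j : UN (k + 1)) : Matrix _ _ ℂ) x y =
      if (x j ≠ y j ∧ ∀ l, l ≠ j → x l = y l) then 1 else 0 := by
    rw [onQubit_apply]
    generalize x j = a
    generalize y j = b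
    by_cases h : ∀ l, l ≠ j → x l = y l
    · fin_cases a <;> fin_cases b <;> simp [gX, matX, h]
    · simp [h]
  by_cases hxy : x j ≠ y j ∧ ∀ l, l ≠ j → x l = y l
  · rw [if_pos hxy] at hX
    obtain ⟨ha, hb⟩ := hxy
    by_cases h1 : j = i.castSucc
    · rw [if_pos h1, onQubit_gZ_mul_apply, hX]
      clear hX
      subst h1
      simp only [czSign, ← hb i.succ hne.symm]
      generalize x i.castSucc = a at ha ⊢
      generalize y i.castSucc = b at ha ⊢
      generalize x i.succ = c
      fin_cases a <;> fin_cases b <;> fin_cases c <;> simp at ha ⊢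
    · rw [if_neg h1]
      by_cases h2 : j = i.succ
      · rw [if_pos h2, onQubit_gZ_mul_apply, hX]
        clear hX
        subst h2
        simp only [czSign, ← hb i.castSucc hne]
        generalize x i.succ = a at ha ⊢
        generalize y i.succ = b at ha ⊢
        generalize x i.castSucc = c
        fin_cases a <;> fin_cases b <;> fin_cases c <;> simp at ha ⊢
      · rw [if_neg h2]
        simp only [czSign, hb i.castSucc (Ne.symm h1), hb i.succ (Ne.symm h2), mul_comm]
  · rw [if_neg hxy] at hX
    split_ifs <;> simp only [onQubit_gZ_mul_apply, hX, mul_zero, zero_mul]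

theorem uCZ_mem {k : ℕ} (i : Fin k) : uCZ i ∈ Cliff (k + 1) := by
  refine mem_Cliff_of_conj (m := 1) ?_ (fun j => ?_) (fun j => ?_)
  · rw [pow_two, uCZ_mul_self]
  · rw [uCZ_conj_gX]
    split_ifs
    · exact mul_mem (onQubit_gZ_mem _) (onQubit_gX_mem j)
    · exact mul_mem (onQubit_gZ_mem _) (onQubit_gX_mem j)
    · exact onQubit_gX_mem j
  · rw [uCZ_conj_gZ]
    exact onQubit_gZ_mem j

theorem omegaI_mem (n : ℕ) : omegaI n ∈ Cliff n := by
  rw [Cliff, Subgroup.mem_normalizer_iff]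
  intro P
  have h : omegaI n * P * (omegaI n)⁻¹ = P := by rw [← omegaI_comm, mul_inv_cancel_right]
  rw [h]

/-- The group `⟨ω I⟩` of scalar matrices, as a subgroup of the Clifford group. -/
def scalars (n : ℕ) : Subgroup (Cliff n) := Subgroup.zpowers ⟨omegaI n, omegaI_mem n⟩

instance scalars_normal (n : ℕ) : (scalars n).Normal := by
  refine ⟨fun a ha g => ?_⟩
  have hc : Commute g (⟨omegaI n, omegaI_mem n⟩ : Cliff n) := Subtype.ext (omegaI_comm g.1)
  obtain ⟨r, rfl⟩ := Subgroup.mem_zpowers_iff.1 ha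
  rw [(hc.zpow_right r).eq, mul_inv_cancel_right]
  exact Subgroup.zpow_mem_zpowers _ r

/-- The `n`-qubit projective Clifford group `Cliff n / ⟨ω I⟩`. Its product is written from left to
right (circuit order), opposite to the order of matrix multiplication; hence `ᵐᵒᵖ`. -/
abbrev ProjCliff (n : ℕ) := (Cliff n ⧸ scalars n)ᵐᵒᵖ

/-- The class `[U]` of a Clifford operator. -/
def toProj {n : ℕ} (U : Cliff n) : ProjCliff n := MulOpposite.op (QuotientGroup.mk U)

/-! ### Generators; qubits are numbered from `0` -/

/-- The class of the Hadamard gate on the qubit `i`. -/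
def h {n : ℕ} (i : Fin n) : ProjCliff n := toProj ⟨onQubit gH i, onQubit_gH_mem i⟩

/-- The class of the phase gate on the qubit `i`. -/
def s {n : ℕ} (i : Fin n) : ProjCliff n := toProj ⟨onQubit gS i, onQubit_gS_mem i⟩

/-- The class of the controlled `Z` gate on the qubits `i`, `i + 1`. -/
def cz {k : ℕ} (i : Fin k) : ProjCliff (k + 1) := toProj ⟨uCZ i, uCZ_mem i⟩

/-- `M = h₂ Λ₁ s₂² h₂ h₁ s₁² h₂ Λ₁ h₂` (with qubits and gates numbered from `1` here). -/
def elemM (k : ℕ) : ProjCliff (k + 2) :=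
  h 1 * cz 0 * s 1 ^ 2 * h 1 * h 0 * s 0 ^ 2 * h 1 * cz 0 * h 1

/-- The inertia subgroup, given by generators (a dummy value for `n = 0`). -/
def IN : (n : ℕ) → Subgroup (ProjCliff n)
  | 0 => ⊥
  | 1 => Subgroup.closure {h 0, s 0 ^ 3 * h 0 * s 0 * h 0 * s 0}
  | 2 => Subgroup.closure {h 0, h 1, s 1, h 0 * s 0 ^ 2 * h 0, elemM 0}
  | k + 3 => Subgroup.closure
      ({g | ∃ i : Fin (k + 3), g = h i} ∪ {g | ∃ i : Fin (k + 3), i ≠ 0 ∧ g = s i} ∪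
        {elemM (k + 1)} ∪ {g | ∃ i : Fin (k + 2), i ≠ 0 ∧ g = cz i})

/-- The subgroup `F n` (a dummy value for `n = 0`). -/
def F : (n : ℕ) → Subgroup (ProjCliff n)
  | 0 => ⊥
  | 1 => Subgroup.closure {s 0 ^ 3 * h 0 * s 0 * h 0 * s 0}
  | 2 => Subgroup.closure {h 1, s 1, h 0 * s 0 ^ 2 * h 0, elemM 0}
  | k + 3 => Subgroup.closure
      ({g | ∃ i : Fin (k + 3), i ≠ 0 ∧ g = h i} ∪ {g | ∃ i : Fin (k + 3), i ≠ 0 ∧ g = s i} ∪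
        {elemM (k + 1)} ∪ {g | ∃ i : Fin (k + 2), i ≠ 0 ∧ g = cz i})

end

end QubitClifford

/-!
The generators of `IN n` are those of `F n` together with the involution `h 0`. So it suffices that
`h 0` normalizes `F n` and does not belong to it: then `IN n = F n ∪ F n * h 0`.

For normality, `h 0` commutes with every generator supported away from the first qubit, and it
inverts `M` because `h 0 * M` is an involution. For `n = 1`, the generator of `F 1` is
`s ^ 2 * h`, a product of two involutions, so `h` inverts it as well. For `n = 2`, conjugation by
`h 0` turns `h 0 * s 0 ^ 2 * h 0` into `s 0 ^ 2`, and `h 0 * M * h 1` conjugates `s 0 ^ 2` to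
`s 0 ^ 2 * s 1 ^ 2`, which expresses `s 0 ^ 2` through the generators of `F 2`.

To see that `h 0` is not in `F n`, let the Clifford group act by conjugation. For `n ≠ 2` the
generators of `F n` fix `X₀ Z₀`, while `h 0` sends it to `Z₀ X₀ = -X₀ Z₀`. The generator
`h 0 * s 0 ^ 2 * h 0` of `F 2` does not fix `X₀ Z₀`, but it permutes, up to phases, the operators
`X₀`, `Z₀ X₁`, `Z₀ X₁ Z₁`, `Z₀ Z₁`, and so do the others; `h 0` does not.

For finiteness, the gates `H`, `S`, `CZ` on `n` qubits have fourth power `1`, so the operators they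
generate have fourth roots of unity as determinants. A Clifford operator is determined up to a
scalar by its action on the finite group of Pauli operators, and only finitely many scalars have
such a determinant.
-/

namespace QubitClifford

section Group

variable {G : Type*} [Group G]

theorem zpow_mem_iff_even {H : Subgroup G} {t : G} (hsq : t ^ 2 ∈ H) (ht : t ∉ H) (r : ℤ) :
    t ^ r ∈ H ↔ Even r := by
  have heven (m : ℤ) : t ^ (2 * m) ∈ H := by
    rw [zpow_mul, zpow_ofNat]
    exact zpow_mem hsq m
  rcases Int.even_or_odd' r with ⟨m, rfl | rfl⟩
  · exact iff_of_true (heven m) (even_two_mul m)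
  · rw [zpow_add_one, H.mul_mem_cancel_left (heven m)]
    exact iff_of_false ht (Int.not_even_two_mul_add_one m)

theorem relIndex_sup_zpowers_eq_two {H : Subgroup G} {t : G}
    (hnorm : t ∈ Subgroup.normalizer (H : Set G)) (hsq : t ^ 2 ∈ H) (ht : t ∉ H) :
    H.relIndex (H ⊔ Subgroup.zpowers t) = 2 := by
  have htsup : t ∈ H ⊔ Subgroup.zpowers t :=
    Subgroup.mem_sup_right (Subgroup.mem_zpowers t)
  refine Subgroup.index_eq_two_iff'.2 ⟨⟨t, htsup⟩, fun ⟨b, hb⟩ => ?_⟩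
  rw [sup_comm, ← SetLike.mem_coe, Subgroup.coe_mul_of_left_le_normalizer_right _ _
    (Subgroup.zpowers_le.2 hnorm)] at hb
  obtain ⟨_, ⟨r, rfl⟩, g, hg, rfl⟩ := hb
  simp only [Subgroup.mem_subgroupOf, Subgroup.coe_mul, ← mul_assoc, ← zpow_one_add,
    H.mul_mem_cancel_right hg, zpow_mem_iff_even hsq ht, add_comm (1 : ℤ), Int.even_add_one]
  rw [xor_def]
  tauto

theorem mem_normalizer_closure {S : Set G} {t : G} (ht : t * t = 1)
    (hS : ∀ g ∈ S, t * g * t ∈ Subgroup.closure S) :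
    t ∈ Subgroup.normalizer (Subgroup.closure S : Set G) := by
  have hinv : t⁻¹ = t := inv_eq_of_mul_eq_one_left ht
  refine Subgroup.zpowers_le.1 (Subgroup.le_normalizer_closure_iff.2 ?_)
  rintro _ ⟨r, rfl⟩ g hg
  rcases Int.even_or_odd' r with ⟨m, rfl | rfl⟩
  · simpa [zpow_mul, pow_two, ht] using Subgroup.subset_closure hg
  · simpa [zpow_add, zpow_mul, pow_two, ht, hinv] using hS g hg

theorem finite_of_le_normalizer {P K : Subgroup G} [Finite P]
    (hK : K ≤ Subgroup.normalizer (P : Set G))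
    (hfin : Finite (K ⊓ Subgroup.centralizer (P : Set G) : Subgroup G)) : Finite K := by
  let conj : K →* MulAut P := P.normalizerMonoidHom.comp (Subgroup.inclusion hK)
  have : Finite (MulAut P) := Finite.of_injective _ DFunLike.coe_injective
  refine conj.finite_iff_finite_ker_range.2 ⟨?_, inferInstance⟩
  have hker (g : conj.ker) : (g : G) ∈ K ⊓ Subgroup.centralizer (P : Set G) := by
    have hg : Subgroup.inclusion hK g ∈ P.normalizerMonoidHom.ker := g.2
    rw [Subgroup.normalizerMonoidHom_ker, Subgroup.mem_subgroupOf] at hg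
    exact ⟨g.1.2, hg⟩
  refine Finite.of_injective (fun g : conj.ker => (⟨g, hker g⟩ : ↥(K ⊓ _))) fun a b hab => ?_
  exact Subtype.ext (Subtype.ext (Subtype.mk.inj hab))

theorem mul_mul_mul_mul_cancel {a : G} (ha : a * a = 1) (x : G) : a * (a * x * a) * a = x := by
  rw [mul_assoc a x, ← mul_assoc a a, ha, one_mul, mul_assoc, ha, mul_one]

theorem mul_mul_mul_eq_inv {a b : G} (ha : a * a = 1) (hb : b * b = 1) :
    a * (b * a) * a = (b * a)⁻¹ := by
  rw [mul_inv_rev, inv_eq_of_mul_eq_one_left ha, inv_eq_of_mul_eq_one_left hb, mul_assoc a (b * a),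
    mul_assoc b, ha, mul_one]

theorem mul_mul_eq_of_commute {a g : G} (ha : a * a = 1) (hg : Commute a g) : a * g * a = g := by
  rw [hg.eq, mul_assoc, ha, mul_one]

theorem mem_of_conj_eq_mul {H : Subgroup G} {a w x z : G} (ha : a * a = 1) (hx : a * x * a ∈ H)
    (hw : w ∈ H) (hz : z ∈ H) (hconj : (a * w)⁻¹ * x * (a * w) = x * z) : x ∈ H := by
  have hword : w⁻¹ * (a * x * a) * w = x * z := by
    rw [← hconj, mul_inv_rev, inv_eq_of_mul_eq_one_left ha]
    group
  rw [← H.mul_mem_cancel_right hz, ← hword]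
  exact mul_mem (mul_mem (inv_mem hw) hx) hw

theorem conj_mul_mul_sq_eq_one {b l z : G} (hbb : b * b = 1) (hll : l * l = 1) (hzz : z * z = 1)
    (hzl : Commute z l) (hword : Commute (b * l * b) (l * z)) :
    (b * l * b * (l * z)) ^ 2 = 1 := by
  have hconj : (b * l * b) ^ 2 = 1 := by
    calc (b * l * b) ^ 2 = b * l * (b * b) * l * b := by rw [pow_two]; group
      _ = b * (l * l) * b := by rw [hbb]; group
      _ = 1 := by rw [hll, mul_one, hbb]
  have hprod : (l * z) ^ 2 = 1 := by
    rw [hzl.symm.mul_pow, pow_two, pow_two, hll, hzz, one_mul]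
  rw [hword.mul_pow, hconj, hprod, one_mul]

theorem mul_word_sq_eq_one {a b l w z : G} (haa : a * a = 1) (hww : w * w = 1) (hab : Commute b a)
    (hza : Commute z a) (hbw : Commute b w) (hlw : Commute l w) (hzw : Commute z w)
    (hzl : Commute z l) (hword : (b * l * b * (l * z)) ^ 2 = 1) :
    (b * (a * l * w * a * b * z * a * l * a)) ^ 2 = 1 := by
  have hconj : b * (a * l * w * a * b * z * a * l * a) =
      a * (w * (b * l * b * (l * z))) * a := by
    calc b * (a * l * w * a * b * z * a * l * a)
        = b * a * l * w * a * (b * z * a) * l * a := by group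
      _ = a * (b * l * w) * (a * a) * b * (z * l) * a := by
        rw [(hab.mul_left hza).eq, hab.eq]; group
      _ = a * (w * (b * l * b * (l * z))) * a := by
        rw [(hbw.mul_left hlw).eq, haa, hzl.eq]; group
  have hw : Commute w (b * l * b * (l * z)) :=
    (((hbw.mul_left hlw).mul_left hbw).mul_left (hlw.mul_left hzw)).symm
  calc (b * (a * l * w * a * b * z * a * l * a)) ^ 2
      = a * (w * (b * l * b * (l * z))) * (a * a) * (w * (b * l * b * (l * z))) * a := by
        rw [hconj, pow_two]; group
    _ = a * (w * (b * l * b * (l * z))) ^ 2 * a := by rw [haa, pow_two]; group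
    _ = 1 := by rw [hw.mul_pow, hword, pow_two, hww, mul_one, mul_one, haa]

end Group

/-! ### Finiteness of `IN n` -/

section Unitary

variable {ι : Type*} [Fintype ι] [DecidableEq ι]

/-- The unitary matrices whose determinant is an `m`-th root of unity. Only finitely many
scalars are among them. -/
def unitaryDetPow (ι : Type*) [Fintype ι] [DecidableEq ι] (m : ℕ) :
    Subgroup (Matrix.unitaryGroup ι ℂ) :=
  (rootsOfUnity m ℂ).comap ((Units.map Matrix.detMonoidHom).comp Unitary.toUnits)

theorem mem_unitaryDetPow {m : ℕ} {U : Matrix.unitaryGroup ι ℂ} :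
    U ∈ unitaryDetPow ι m ↔ (U : Matrix ι ι ℂ).det ^ m = 1 := by
  simp [unitaryDetPow, mem_rootsOfUnity, Units.ext_iff]

theorem mem_unitaryDetPow_of_pow_eq_one {m : ℕ} {U : Matrix.unitaryGroup ι ℂ} (hU : U ^ m = 1) :
    U ∈ unitaryDetPow ι m := by
  rw [mem_unitaryDetPow, ← Matrix.det_pow, ← SubmonoidClass.coe_pow, hU, OneMemClass.coe_one,
    Matrix.det_one]

theorem finite_scalar_unitaryDetPow [Nonempty ι] {m : ℕ} (hm : m ≠ 0) :
    {U ∈ unitaryDetPow ι m | ∃ c : ℂ, (U : Matrix ι ι ℂ) = c • 1}.Finite := by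
  have hroots : {c : ℂ | c ^ (Fintype.card ι * m) = 1}.Finite := by
    refine (Polynomial.nthRootsFinset (Fintype.card ι * m) (1 : ℂ)).finite_toSet.subset ?_
    exact fun c hc => (Polynomial.mem_nthRootsFinset (by positivity) 1).2 hc
  refine ((hroots.image fun c => c • (1 : Matrix ι ι ℂ)).preimage
    Subtype.val_injective.injOn).subset ?_
  rintro U ⟨hU, c, hc⟩
  rw [mem_unitaryDetPow, hc, Matrix.det_smul, Matrix.det_one, mul_one, ← pow_mul] at hU
  exact ⟨c, hU, hc.symm⟩

/-- The unitary matrices whose entries are Gaussian integers, a finite group that contains the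
Pauli group. -/
def gaussianUnitary (ι : Type*) [Fintype ι] [DecidableEq ι] :
    Subgroup (Matrix.unitaryGroup ι ℂ) where
  carrier := {U | ∀ x y, (U : Matrix ι ι ℂ) x y ∈ GaussianInt.toComplex.range}
  mul_mem' {U V} hU hV x y := by
    rw [Submonoid.coe_mul, Matrix.mul_apply]
    exact sum_mem fun z _ => mul_mem (hU x z) (hV z y)
  one_mem' x y := by
    rw [Submonoid.coe_one, Matrix.one_apply]
    split_ifs
    exacts [one_mem _, zero_mem _]
  inv_mem' {U} hU x y := by
    obtain ⟨z, hz⟩ := hU y x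
    exact ⟨star z, by rw [GaussianInt.toComplex_star, hz]; rfl⟩

theorem finite_gaussianInt_norm_le (r : ℝ) : {z : GaussianInt | ‖(z : ℂ)‖ ≤ r}.Finite := by
  refine (((Set.finite_Icc (-⌊r⌋) ⌊r⌋).prod (Set.finite_Icc (-⌊r⌋) ⌊r⌋)).preimage
    (f := fun z : GaussianInt => (z.re, z.im)) fun z _ w _ hzw => ?_).subset fun z hz => ?_
  · exact Zsqrtd.ext (congrArg Prod.fst hzw) (congrArg Prod.snd hzw)
  · have hre := (Complex.abs_re_le_norm (z : ℂ)).trans hz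
    have him := (Complex.abs_im_le_norm (z : ℂ)).trans hz
    rw [← GaussianInt.intCast_re, ← Int.cast_abs, ← Int.le_floor, abs_le] at hre
    rw [← GaussianInt.intCast_im, ← Int.cast_abs, ← Int.le_floor, abs_le] at him
    exact ⟨hre, him⟩

instance finite_gaussianUnitary : Finite (gaussianUnitary ι) := by
  have hentries : (GaussianInt.toComplex '' {z | ‖(z : ℂ)‖ ≤ 1}).Finite :=
    (finite_gaussianInt_norm_le 1).image _
  have hmatrices : {A : Matrix ι ι ℂ | ∀ x y,
      A x y ∈ GaussianInt.toComplex '' {z | ‖(z : ℂ)‖ ≤ 1}}.Finite :=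
    Set.Finite.pi' fun _ => Set.Finite.pi' fun _ => hentries
  refine ((hmatrices.preimage Subtype.val_injective.injOn).subset fun U hU x y => ?_).to_subtype
  obtain ⟨z, hz⟩ := hU x y
  exact ⟨z, (congrArg norm hz).trans_le (entry_norm_bound_of_unitary U.2 x y), hz⟩

end Unitary

/-- Operators on `n` qubits, as matrices indexed by the bit strings. -/
abbrev QubitMatrix (n : ℕ) := Matrix (Fin n → Fin 2) (Fin n → Fin 2) ℂ

theorem Pauli_le_gaussianUnitary (n : ℕ) : Pauli n ≤ gaussianUnitary (Fin n → Fin 2) := by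
  have hite (p : Prop) [Decidable p] :
      (if p then (1 : ℂ) else 0) ∈ GaussianInt.toComplex.range := by
    split_ifs
    exacts [one_mem _, zero_mem _]
  have hX (a b : Fin 2) : matX a b ∈ GaussianInt.toComplex.range := by
    fin_cases a <;> fin_cases b
    exacts [zero_mem _, one_mem _, one_mem _, zero_mem _]
  have hZ (a b : Fin 2) : matZ a b ∈ GaussianInt.toComplex.range := by
    fin_cases a <;> fin_cases b
    exacts [one_mem _, zero_mem _, zero_mem _, neg_mem (one_mem _)]
  rw [Pauli, Subgroup.closure_le]
  rintro P ((⟨i, rfl⟩ | ⟨i, rfl⟩) | rfl) x y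
  · rw [onQubit_apply]
    exact mul_mem (hX _ _) (hite _)
  · rw [onQubit_apply]
    exact mul_mem (hZ _ _) (hite _)
  · have hentry : ((omegaI n ^ 2 : UN n) : Matrix _ _ ℂ) x y =
        Complex.I * if x = y then 1 else 0 := by
      simp [omegaI, pow_two, ← omega_sq, Matrix.one_apply]
    rw [hentry]
    exact mul_mem ⟨⟨0, 1⟩, by simp [GaussianInt.toComplex_def]⟩ (hite _)

instance finite_Pauli (n : ℕ) : Finite (Pauli n) :=
  Finite.of_injective _ (Subgroup.inclusion_injective (Pauli_le_gaussianUnitary n))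

theorem onQubit_gZ_eq_diagonal {n : ℕ} (i : Fin n) :
    ((onQubit gZ i : UN n) : QubitMatrix n) =
      Matrix.diagonal fun x => if x i = 1 then -1 else 1 := by
  ext x y
  rw [← mul_one (onQubit gZ i), onQubit_gZ_mul_apply, Submonoid.coe_one, Matrix.one_apply,
    Matrix.diagonal_apply, mul_ite, mul_one, mul_zero]

theorem onQubit_gX_eq_permMatrix {n : ℕ} (i : Fin n) :
    ((onQubit gX i : UN n) : QubitMatrix n) =
      (Equiv.addRight (Pi.single i 1)).toPEquiv.toMatrix := by
  have hX (a b : Fin 2) : (gX : Matrix (Fin 2) (Fin 2) ℂ) a b = if a + 1 = b then 1 else 0 := by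
    fin_cases a <;> fin_cases b <;> rfl
  ext x y
  have hflip : x + Pi.single i 1 = Function.update x i (x i + 1) := by
    funext j
    obtain rfl | hj := eq_or_ne j i
    · simp
    · simp [hj]
  rw [onQubit_apply, PEquiv.toMatrix_apply]
  simp only [Equiv.toPEquiv_apply, Option.mem_some_iff, Equiv.coe_addRight, hflip,
    Function.update_eq_iff, ite_and, hX, ite_mul, one_mul, zero_mul]

theorem exists_eq_smul_one_of_mem_centralizer_Pauli {n : ℕ} {U : UN n}
    (hU : U ∈ Subgroup.centralizer (Pauli n : Set (UN n))) :
    ∃ c : ℂ, (U : QubitMatrix n) = c • 1 := by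
  set A : QubitMatrix n := U.1
  have hcomm (P : UN n) (hP : P ∈ Pauli n) :
      (P : QubitMatrix n) * A = A * P :=
    congrArg Subtype.val (Subgroup.mem_centralizer_iff.1 hU P hP)
  have hoffDiag (x y : Fin n → Fin 2) (hxy : x ≠ y) : A x y = 0 := by
    obtain ⟨i, hi⟩ := Function.ne_iff.1 hxy
    have hZ := congrFun₂ (hcomm _ (onQubit_gZ_mem i)) x y
    rw [onQubit_gZ_eq_diagonal, Matrix.diagonal_mul, Matrix.mul_diagonal, mul_comm,
      ← sub_eq_zero, ← mul_sub] at hZ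
    refine (mul_eq_zero.1 hZ).resolve_right ?_
    generalize x i = a, y i = b at hi
    revert hi
    fin_cases a <;> fin_cases b <;> norm_num
  have hdiag (v : Fin n → Fin 2) : ∀ x, A (x + v) (x + v) = A x x := by
    refine Pi.single_induction (fun v => ∀ x, A (x + v) (x + v) = A x x) v (by simp)
      (fun v w hv hw x => by rw [← add_assoc, hw, hv]) fun i b x => ?_
    have hX := congrFun₂ (hcomm _ (onQubit_gX_mem i)) x (x + Pi.single i 1)
    rw [onQubit_gX_eq_permMatrix, PEquiv.toMatrix_toPEquiv_mul, PEquiv.mul_toMatrix_toPEquiv] at hX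
    fin_cases b
    · simp
    · simpa using hX
  refine ⟨A 0 0, Matrix.ext fun x y => ?_⟩
  rw [Matrix.smul_apply, Matrix.one_apply]
  split_ifs with hxy
  · rw [← hxy, ← zero_add x, hdiag x 0, smul_eq_mul, mul_one]
  · rw [hoffDiag x y hxy, smul_zero]

noncomputable section

instance finite_Cliff_inf_unitaryDetPow (n : ℕ) :
    Finite (Cliff n ⊓ unitaryDetPow (Fin n → Fin 2) 4 : Subgroup (UN n)) := by
  refine finite_of_le_normalizer (P := Pauli n) inf_le_left ?_
  refine ((finite_scalar_unitaryDetPow four_ne_zero).subset fun U hU => ?_).to_subtype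
  exact ⟨hU.1.2, exists_eq_smul_one_of_mem_centralizer_Pauli hU.2⟩

/-- The classes of the Clifford operators whose determinant is a fourth root of unity. All the
generators of `IN n` are such, and these classes form a finite group. -/
def projDetFour (n : ℕ) : Subgroup (ProjCliff n) :=
  (((unitaryDetPow (Fin n → Fin 2) 4).subgroupOf (Cliff n)).map (QuotientGroup.mk' (scalars n))).op

theorem toProj_mem_projDetFour {n : ℕ} {U : Cliff n} (hU : (U : UN n) ^ 4 = 1) :
    toProj U ∈ projDetFour n :=
  Subgroup.mem_map_of_mem (QuotientGroup.mk' (scalars n)) (mem_unitaryDetPow_of_pow_eq_one hU)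

instance finite_projDetFour (n : ℕ) : Finite (projDetFour n) := by
  have hfin : Finite ((unitaryDetPow (Fin n → Fin 2) 4).subgroupOf (Cliff n)) :=
    Finite.of_injective (fun U => (⟨U, U.1.2, U.2⟩ : ↥(Cliff n ⊓ unitaryDetPow _ 4)))
      fun U V hUV => Subtype.ext (Subtype.ext (Subtype.mk.inj hUV))
  have hmap := (Set.toFinite ((unitaryDetPow (Fin n → Fin 2) 4).subgroupOf (Cliff n) :
    Set (Cliff n))).image (QuotientGroup.mk' (scalars n))
  exact (hmap.preimage MulOpposite.unop_injective.injOn).to_subtype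

theorem h_mem_projDetFour {n : ℕ} (i : Fin n) : h i ∈ projDetFour n :=
  toProj_mem_projDetFour <| by rw [onQubit_pow, pow_mul gH 2 2, gH_sq, one_pow, onQubit_one]

theorem s_mem_projDetFour {n : ℕ} (i : Fin n) : s i ∈ projDetFour n :=
  toProj_mem_projDetFour <| by rw [onQubit_pow, gS_pow, onQubit_one]

theorem cz_mem_projDetFour {k : ℕ} (i : Fin k) : cz i ∈ projDetFour (k + 1) :=
  toProj_mem_projDetFour <| (pow_mul (uCZ i) 2 2).trans <| by
    rw [pow_two (uCZ i), uCZ_mul_self, one_pow]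

theorem elemM_mem_projDetFour (k : ℕ) : elemM k ∈ projDetFour (k + 2) := by
  have hh := h_mem_projDetFour (n := k + 2)
  have hs := s_mem_projDetFour (n := k + 2)
  have hcz := cz_mem_projDetFour (0 : Fin (k + 1))
  exact mul_mem (mul_mem (mul_mem (mul_mem (mul_mem (mul_mem (mul_mem (mul_mem (hh 1) hcz)
    (pow_mem (hs 1) 2)) (hh 1)) (hh 0)) (pow_mem (hs 0) 2)) (hh 1)) hcz) (hh 1)

theorem IN_le_projDetFour : ∀ n, IN n ≤ projDetFour n
  | 0 => bot_le
  | 1 => by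
    have hh := h_mem_projDetFour (0 : Fin 1)
    have hs := s_mem_projDetFour (0 : Fin 1)
    rw [IN, Subgroup.closure_le]
    rintro _ (rfl | rfl)
    exacts [hh, mul_mem (mul_mem (mul_mem (mul_mem (pow_mem hs 3) hh) hs) hh) hs]
  | 2 => by
    have hh := h_mem_projDetFour (n := 2)
    have hs := s_mem_projDetFour (n := 2)
    rw [IN, Subgroup.closure_le]
    rintro _ (rfl | rfl | rfl | rfl | rfl)
    exacts [hh 0, hh 1, hs 1, mul_mem (mul_mem (hh 0) (pow_mem (hs 0) 2)) (hh 0),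
      elemM_mem_projDetFour 0]
  | k + 3 => by
    rw [IN, Subgroup.closure_le]
    rintro _ (((⟨i, rfl⟩ | ⟨i, -, rfl⟩) | rfl) | ⟨i, -, rfl⟩)
    exacts [h_mem_projDetFour i, s_mem_projDetFour i, elemM_mem_projDetFour _,
      cz_mem_projDetFour i]

instance finite_IN (n : ℕ) : Finite (IN n) :=
  Finite.of_injective _ (Subgroup.inclusion_injective (IN_le_projDetFour n))

/-! ### Inversion of `M` by `h 0` -/

theorem commute_add_one_sub_mul {R : Type*} [Ring R] {p a b : R} (hp : IsIdempotentElem p)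
    (ha : Commute p a) (hb : Commute p b) : Commute (p + (1 - p) * b) (p * a + (1 - p)) := by
  have hpq : Commute p (1 - p) := (Commute.one_right p).sub_right (Commute.refl p)
  have hqb : Commute (1 - p) b := (Commute.one_left b).sub_left hb
  have hcross : Commute ((1 - p) * b) (p * a) := by
    have hleft : (1 - p) * b * (p * a) = 0 := by
      rw [hqb.eq, mul_assoc, ← mul_assoc (1 - p), hp.one_sub_mul_self, zero_mul, mul_zero]
    have hright : p * a * ((1 - p) * b) = 0 := by
      rw [ha.eq, mul_assoc, ← mul_assoc p, hp.mul_one_sub_self, zero_mul, mul_zero]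
    exact hleft.trans hright.symm
  exact (((Commute.refl p).mul_right ha).add_right hpq).add_left
    (hcross.add_right ((Commute.refl (1 - p)).mul_left hqb.symm))

-- `t * c * t` acts only on the range of `1 - p`, while `z * c`, in which the two copies of `z`
-- cancel on that range, acts only on the range of `p`.
theorem commute_controlled_conj {R : Type*} [Ring R] {p z t c : R} (hp : IsIdempotentElem p)
    (hz : Commute p z) (ht : Commute p t) (hzz : z * z = 1) (htt : t * t = 1)
    (hc : c = p + (1 - p) * z) : Commute (t * c * t) (z * c) := by
  have hqt : Commute (1 - p) t := (Commute.one_left t).sub_left ht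
  have hqz : Commute (1 - p) z := (Commute.one_left z).sub_left hz
  have hconj : t * c * t = p + (1 - p) * (t * z * t) := by
    calc t * c * t = t * p * t + t * (1 - p) * z * t := by
          rw [hc, mul_add, add_mul, mul_assoc t _ z]
      _ = p * (t * t) + (1 - p) * (t * z * t) := by
        rw [← ht.eq, ← hqt.eq]
        simp only [mul_assoc]
      _ = p + (1 - p) * (t * z * t) := by rw [htt, mul_one]
  have hmul : z * c = p * z + (1 - p) := by
    rw [hc, mul_add, ← hz.eq, hqz.eq, ← mul_assoc, hzz, one_mul]
  rw [hconj, hmul]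
  exact commute_add_one_sub_mul hp hz ((ht.mul_right hz).mul_right ht)

theorem gS_sq : gS ^ 2 = gZ := by
  apply Subtype.ext
  change matS ^ 2 = matZ
  ext a b
  rw [matS, omega_sq]
  fin_cases a <;> fin_cases b <;> simp [pow_succ, matZ]

/-- The projection of the qubit `i` onto the basis state `0`. It exhibits a controlled gate as the
sum of its two branches. -/
def projZero {n : ℕ} (i : Fin n) : QubitMatrix n :=
  Matrix.diagonal fun x => if x i = 0 then 1 else 0

theorem isIdempotentElem_projZero {n : ℕ} (i : Fin n) : IsIdempotentElem (projZero i) := by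
  simp [IsIdempotentElem, projZero, Matrix.diagonal_mul_diagonal]

theorem projZero_commute_onQubit {n : ℕ} (U : U2) {i j : Fin n} (hij : i ≠ j) :
    Commute (projZero i) ((onQubit U j : UN n) : QubitMatrix n) := by
  ext x y
  rw [projZero, Matrix.diagonal_mul, Matrix.mul_diagonal, onQubit_apply]
  by_cases hxy : ∀ l, l ≠ j → x l = y l
  · rw [hxy i hij, mul_comm]
  · simp [hxy]

theorem uCZ_eq_projZero_add {k : ℕ} (i : Fin k) :
    ((uCZ i : UN (k + 1)) : QubitMatrix (k + 1)) =
      projZero i.succ + (1 - projZero i.succ) * (onQubit gZ i.castSucc : UN (k + 1)) := by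
  change onPair matCZ i = _
  rw [onPair_matCZ, projZero, onQubit_gZ_eq_diagonal, ← Matrix.diagonal_one,
    Matrix.diagonal_sub, Matrix.diagonal_mul_diagonal, Matrix.diagonal_add]
  congr 1
  funext x
  simp only [czSign, Prod.mk.injEq]
  generalize x i.succ = a, x i.castSucc = b
  fin_cases a <;> fin_cases b <;> simp

theorem onQubit_gH_mul_self {n : ℕ} (i : Fin n) : onQubit gH i * onQubit gH i = (1 : UN n) := by
  rw [onQubit_mul, ← pow_two, gH_sq, onQubit_one]

theorem onQubit_gZ_mul_self {n : ℕ} (i : Fin n) : onQubit gZ i * onQubit gZ i = (1 : UN n) := by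
  rw [onQubit_mul, ← gS_sq, ← pow_add, gS_pow, onQubit_one]

theorem commute_gH_conj_uCZ {k : ℕ} (i : Fin k) :
    Commute (onQubit gH i.castSucc * uCZ i * onQubit gH i.castSucc)
      (onQubit gZ i.castSucc * uCZ i) :=
  have hne : i.succ ≠ i.castSucc := i.castSucc_lt_succ.ne'
  Subtype.ext <| commute_controlled_conj (isIdempotentElem_projZero i.succ)
    (projZero_commute_onQubit gZ hne) (projZero_commute_onQubit gH hne)
    (congrArg Subtype.val (onQubit_gZ_mul_self i.castSucc))
    (congrArg Subtype.val (onQubit_gH_mul_self i.castSucc)) (uCZ_eq_projZero_add i)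

theorem onQubit_gZ_mem_Cliff {n : ℕ} (i : Fin n) : onQubit gZ i ∈ Cliff n :=
  Subgroup.le_normalizer (onQubit_gZ_mem i)

theorem toProj_mul {n : ℕ} (U V : Cliff n) : toProj U * toProj V = toProj (V * U) :=
  rfl

theorem toProj_commute {n : ℕ} {U V : Cliff n} (hUV : Commute (U : UN n) V) :
    Commute (toProj U) (toProj V) :=
  congrArg toProj (Subtype.ext hUV.eq.symm : V * U = U * V)

theorem h_commute_h {n : ℕ} {i j : Fin n} (hij : i ≠ j) : Commute (h i) (h j) :=
  toProj_commute (onQubit_commute gH gH hij)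

theorem h_commute_s {n : ℕ} {i j : Fin n} (hij : i ≠ j) : Commute (h i) (s j) :=
  toProj_commute (onQubit_commute gH gS hij)

theorem s_commute_s {n : ℕ} {i j : Fin n} (hij : i ≠ j) : Commute (s i) (s j) :=
  toProj_commute (onQubit_commute gS gS hij)

theorem h_commute_cz {k : ℕ} {i : Fin k} {j : Fin (k + 1)}
    (hcast : j ≠ i.castSucc) (hsucc : j ≠ i.succ) : Commute (h j) (cz i) := by
  refine toProj_commute (Subtype.ext (Matrix.ext fun x y => ?_))
  rw [uCZ_mul_apply, mul_uCZ_apply, onQubit_apply]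
  by_cases hxy : ∀ l, l ≠ j → x l = y l
  · simp only [czSign, hxy _ hcast.symm, hxy _ hsucc.symm, mul_comm]
  · simp [hxy]

theorem h_mul_self {n : ℕ} (i : Fin n) : h i * h i = 1 :=
  congrArg toProj (Subtype.ext (onQubit_gH_mul_self i) : (_ : Cliff n) = 1)

theorem cz_mul_self {k : ℕ} (i : Fin k) : cz i * cz i = 1 :=
  congrArg toProj (Subtype.ext (uCZ_mul_self i) : (_ : Cliff (k + 1)) = 1)

theorem s_sq {n : ℕ} (i : Fin n) :
    s i ^ 2 = toProj ⟨onQubit gZ i, onQubit_gZ_mem_Cliff i⟩ := by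
  rw [pow_two, s, toProj_mul]
  refine congrArg toProj (Subtype.ext ?_)
  rw [Subgroup.coe_mul, onQubit_mul, ← pow_two, gS_sq]

theorem s_sq_mul_self {n : ℕ} (i : Fin n) : s i ^ 2 * s i ^ 2 = 1 := by
  rw [s_sq]
  exact congrArg toProj (Subtype.ext (onQubit_gZ_mul_self i) : (_ : Cliff n) = 1)

theorem s_sq_commute_cz {k : ℕ} (i : Fin k) (j : Fin (k + 1)) : Commute (s j ^ 2) (cz i) := by
  rw [s_sq]
  exact toProj_commute (mul_inv_eq_iff_eq_mul.1 (uCZ_conj_gZ i j)).symm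

theorem h_conj_cz_commute_cz_mul_s_sq {k : ℕ} (i : Fin k) :
    Commute (h i.castSucc * cz i * h i.castSucc) (cz i * s i.castSucc ^ 2) := by
  have hcomm := commute_gH_conj_uCZ i
  rw [mul_assoc] at hcomm
  simp only [s_sq, h, cz, toProj_mul]
  exact toProj_commute hcomm

theorem h_zero_mul_elemM_sq (k : ℕ) : (h 0 * elemM k) ^ 2 = 1 := by
  have h01 : (0 : Fin (k + 2)) ≠ 1 := zero_ne_one
  have hword : (h 0 * cz 0 * h 0 * (cz 0 * s 0 ^ 2) : ProjCliff (k + 2)) ^ 2 = 1 :=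
    conj_mul_mul_sq_eq_one (h_mul_self 0) (cz_mul_self 0) (s_sq_mul_self 0) (s_sq_commute_cz 0 0)
      (h_conj_cz_commute_cz_mul_s_sq 0)
  exact mul_word_sq_eq_one (h_mul_self 1) (s_sq_mul_self 1) (h_commute_h h01)
    ((h_commute_s h01.symm).pow_right 2).symm ((h_commute_s h01).pow_right 2)
    (s_sq_commute_cz 0 1).symm ((s_commute_s h01).pow_pow 2 2) (s_sq_commute_cz 0 0) hword

theorem h_zero_mul_elemM_mul_h_zero (k : ℕ) : h 0 * elemM k * h 0 = (elemM k)⁻¹ := by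
  refine eq_inv_of_mul_eq_one_left ?_
  rw [mul_assoc, ← pow_two, h_zero_mul_elemM_sq]

/-! ### Invariants of the conjugation action -/

theorem omegaI_pow_commute {n : ℕ} (U : UN n) (m : ℕ) : Commute U (omegaI n ^ m) :=
  Commute.pow_right (omegaI_comm U) m

theorem coe_omegaI_pow (n m : ℕ) : ((omegaI n ^ m : UN n) : QubitMatrix n) = omega ^ m • 1 := by
  rw [SubmonoidClass.coe_pow, omegaI, smul_pow, one_pow]

theorem onQubit_eq_omegaI_pow_mul {n m : ℕ} {U V : U2}
    (hUV : (U : Matrix (Fin 2) (Fin 2) ℂ) = omega ^ m • (V : Matrix (Fin 2) (Fin 2) ℂ))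
    (i : Fin n) : onQubit U i = omegaI n ^ m * onQubit V i := by
  refine Subtype.ext (Matrix.ext fun x y => ?_)
  rw [Submonoid.coe_mul, coe_omegaI_pow, Matrix.smul_mul, Matrix.one_mul, Matrix.smul_apply,
    onQubit_apply, onQubit_apply, hUV, Matrix.smul_apply, smul_mul_assoc]

theorem omega_pow_four : omega ^ 4 = -1 := by
  rw [pow_mul omega 2 2, omega_sq, Complex.I_sq]

theorem omegaI_pow_four_mul_self (n : ℕ) : omegaI n ^ 4 * omegaI n ^ 4 = 1 := by
  apply Subtype.ext
  rw [← pow_add, coe_omegaI_pow, pow_add, omega_pow_four, neg_mul_neg, one_mul, one_smul]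
  rfl

theorem onQubit_gX_mul_self {n : ℕ} (i : Fin n) : onQubit gX i * onQubit gX i = (1 : UN n) := by
  have hX : gX * gX = 1 := by
    apply Subtype.ext
    ext a b
    fin_cases a <;> fin_cases b <;> simp [gX, matX]
  rw [onQubit_mul, hX, onQubit_one]

theorem onQubit_gZ_mul_gX {n : ℕ} (i : Fin n) :
    onQubit gZ i * onQubit gX i = omegaI n ^ 4 * (onQubit gX i * onQubit gZ i) := by
  rw [onQubit_mul, onQubit_mul]
  refine onQubit_eq_omegaI_pow_mul ?_ i
  rw [omega_pow_four]
  ext a b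
  fin_cases a <;> fin_cases b <;> simp [gX, gZ, matX, matZ]

theorem onQubit_gX_not_commute_gZ {n : ℕ} (i : Fin n) :
    ¬ Commute (onQubit gX i) (onQubit gZ i : UN n) := by
  intro hcomm
  rw [commute_iff_eq, eq_comm, onQubit_gZ_mul_gX, mul_eq_right] at hcomm
  have hentry := congrFun₂ ((coe_omegaI_pow n 4).symm.trans (congrArg Subtype.val hcomm)) 0 0
  norm_num [omega_pow_four] at hentry

/-- The conjugation action of the projective Clifford group on the unitary group. The opposite
monoid accounts for the order of products in `ProjCliff`. -/
def conjHom (n : ℕ) : ProjCliff n →* (MulAut (UN n))ᵐᵒᵖ :=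
  MonoidHom.op <| QuotientGroup.lift (scalars n) (MulAut.conj.comp (Cliff n).subtype) <|
    Subgroup.zpowers_le.2 <| MulEquiv.ext fun P =>
      mul_inv_eq_of_eq_mul (omegaI_comm P).symm

/-- The automorphism `P ↦ U * P * U⁻¹` of the unitary group, for the class `g` of `U`. -/
def act {n : ℕ} (g : ProjCliff n) : MulAut (UN n) := (conjHom n g).unop

theorem act_toProj {n : ℕ} (U : Cliff n) (P : UN n) :
    act (toProj U) P = (U : UN n) * P * (U : UN n)⁻¹ :=
  rfl

theorem act_mul {n : ℕ} (a b : ProjCliff n) (P : UN n) : act (a * b) P = act b (act a P) := by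
  simp [act]

theorem toProj_surjective (n : ℕ) : Function.Surjective (toProj : Cliff n → ProjCliff n) :=
  MulOpposite.op_surjective.comp QuotientGroup.mk_surjective

theorem inv_mul_toProj_mul {n : ℕ} (g : ProjCliff n) {P Q : UN n} (hP : P ∈ Cliff n)
    (hQ : Q ∈ Cliff n) (hg : act g P = Q) : g⁻¹ * toProj ⟨P, hP⟩ * g = toProj ⟨Q, hQ⟩ := by
  obtain ⟨U, rfl⟩ := toProj_surjective n g
  have hconj : U * ⟨P, hP⟩ * U⁻¹ = ⟨Q, hQ⟩ := Subtype.ext hg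
  rw [← hconj, mul_assoc]
  rfl

theorem act_omegaI {n : ℕ} (g : ProjCliff n) : act g (omegaI n) = omegaI n := by
  obtain ⟨U, rfl⟩ := toProj_surjective n g
  rw [act_toProj, omegaI_comm, mul_inv_cancel_right]

theorem act_h_gX {n : ℕ} (i j : Fin n) :
    act (h i) (onQubit gX j) = if i = j then onQubit gZ j else onQubit gX j := by
  rw [h, act_toProj, onQubit_conj, gH_conj_gX]

theorem act_h_gZ {n : ℕ} (i j : Fin n) :
    act (h i) (onQubit gZ j) = if i = j then onQubit gX j else onQubit gZ j := by
  rw [h, act_toProj, onQubit_conj, gH_conj_gZ]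

theorem act_s_gX {n : ℕ} (i j : Fin n) : act (s i) (onQubit gX j) =
    if i = j then omegaI n ^ 2 * (onQubit gX j * onQubit gZ j) else onQubit gX j := by
  rw [s, act_toProj, onQubit_conj, onQubit_gS_conj_gX]

theorem act_s_gZ {n : ℕ} (i j : Fin n) : act (s i) (onQubit gZ j) = onQubit gZ j := by
  rw [s, act_toProj, onQubit_conj, gS_conj_gZ, ite_self]

theorem act_s_sq_gX {n : ℕ} (i j : Fin n) : act (s i ^ 2) (onQubit gX j) =
    if i = j then omegaI n ^ 4 * onQubit gX j else onQubit gX j := by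
  rw [s_sq, act_toProj]
  split_ifs with hij
  · rw [hij, onQubit_gZ_mul_gX, ← mul_assoc, mul_inv_cancel_right]
  · rw [onQubit_commute _ _ hij, mul_inv_cancel_right]

theorem act_s_sq_gZ {n : ℕ} (i j : Fin n) : act (s i ^ 2) (onQubit gZ j) = onQubit gZ j := by
  rw [pow_two, act_mul, act_s_gZ, act_s_gZ]

theorem act_cz_gX {k : ℕ} (i : Fin k) (j : Fin (k + 1)) : act (cz i) (onQubit gX j) =
    if j = i.castSucc then onQubit gZ i.succ * onQubit gX j
    else if j = i.succ then onQubit gZ i.castSucc * onQubit gX j else onQubit gX j := by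
  rw [cz, act_toProj, uCZ_conj_gX]

theorem act_cz_gZ {k : ℕ} (i : Fin k) (j : Fin (k + 1)) :
    act (cz i) (onQubit gZ j) = onQubit gZ j := by
  rw [cz, act_toProj, uCZ_conj_gZ]

theorem act_elemM_gX_zero (k : ℕ) :
    act (elemM k) (onQubit gX 0) = onQubit gX 1 * onQubit gZ 0 := by
  simp [elemM, act_mul, act_h_gX, act_h_gZ, act_s_sq_gX, act_s_sq_gZ, act_cz_gX, act_cz_gZ,
    -map_pow]

theorem act_elemM_gZ_zero (k : ℕ) :
    act (elemM k) (onQubit gZ 0) = omegaI _ ^ 4 * (onQubit gX 1 * onQubit gX 0) := by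
  simp [elemM, act_mul, act_h_gX, act_h_gZ, act_s_sq_gX, act_s_sq_gZ, act_cz_gX, act_cz_gZ,
    act_omegaI]

theorem act_elemM_gX_one (k : ℕ) : act (elemM k) (onQubit gX 1) = onQubit gX 1 := by
  simp [elemM, act_mul, act_h_gX, act_h_gZ, act_s_sq_gX, act_s_sq_gZ, act_cz_gZ]

theorem act_elemM_gZ_one (k : ℕ) : act (elemM k) (onQubit gZ 1) =
    onQubit gX 1 * onQubit gX 0 * (onQubit gZ 0 * onQubit gZ 1) := by
  have hact : act (elemM k) (onQubit gZ 1) =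
      omegaI (k + 2) ^ 4 * (onQubit gX 1 * onQubit gX 0) *
        (omegaI (k + 2) ^ 4 * (onQubit gZ 0 * onQubit gZ 1)) := by
    simp [elemM, act_mul, act_h_gX, act_h_gZ, act_s_sq_gX, act_s_sq_gZ, act_cz_gX, act_omegaI]
  rw [hact, ← mul_assoc (_ * _) (omegaI _ ^ 4), (omegaI_pow_commute _ _).eq,
    ← mul_assoc (omegaI _ ^ 4), omegaI_pow_four_mul_self, one_mul]

/-- The stabilizer in the projective Clifford group of a point of any set on which the
automorphisms of the unitary group act (such as operators or sets of operators). -/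
def conjStabilizer {n : ℕ} {α : Type*} [MulAction (MulAut (UN n)) α] (a : α) :
    Subgroup (ProjCliff n) :=
  (MulAction.stabilizer (MulAut (UN n)) a).op.comap (conjHom n)

theorem mem_conjStabilizer {n : ℕ} {α : Type*} [MulAction (MulAut (UN n)) α] {a : α}
    {g : ProjCliff n} : g ∈ conjStabilizer a ↔ act g • a = a :=
  Iff.rfl

open scoped Pointwise

theorem elemM_mem_conjStabilizer_gX_mul_gZ (k : ℕ) :
    elemM k ∈ conjStabilizer (onQubit gX 0 * onQubit gZ 0 : UN (k + 2)) := by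
  have hXZ : onQubit gX 1 * onQubit gZ 0 = (onQubit gZ 0 * onQubit gX 1 : UN (k + 2)) :=
    onQubit_commute _ _ one_ne_zero
  rw [mem_conjStabilizer, MulAut.smul_def, map_mul, act_elemM_gX_zero, act_elemM_gZ_zero,
    (omegaI_pow_commute _ 4).left_comm, hXZ, mul_assoc, ← mul_assoc (onQubit gX 1),
    onQubit_gX_mul_self, one_mul, onQubit_gZ_mul_gX, ← mul_assoc, omegaI_pow_four_mul_self, one_mul]

theorem h_notMem_conjStabilizer_gX_mul_gZ {n : ℕ} (i : Fin n) :
    h i ∉ conjStabilizer (onQubit gX i * onQubit gZ i) := by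
  rw [mem_conjStabilizer, MulAut.smul_def, map_mul, act_h_gX, act_h_gZ, if_pos rfl, if_pos rfl]
  exact fun hfix => onQubit_gX_not_commute_gZ i hfix.symm

/-- Four pairwise anticommuting Pauli operators on the first two qubits, up to powers of `ω`. The
generators of `F 2` permute them, whereas `h 0` sends the first one outside. -/
def tetrad (k : ℕ) : Set (UN (k + 2)) :=
  (Subgroup.zpowers (omegaI (k + 2)) : Set (UN (k + 2))) *
    {onQubit gX 0, onQubit gZ 0 * onQubit gX 1, onQubit gZ 0 * (onQubit gX 1 * onQubit gZ 1),
      onQubit gZ 0 * onQubit gZ 1}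

theorem finite_tetrad (k : ℕ) : (tetrad k).Finite := by
  have hfin : IsOfFinOrder (omegaI (k + 2)) := isOfFinOrder_iff_pow_eq_one.2
    ⟨8, by norm_num, (pow_add (omegaI _) 4 4).trans (omegaI_pow_four_mul_self _)⟩
  exact hfin.finite_zpowers.mul (Set.toFinite _)

theorem mem_tetrad (k : ℕ) :
    onQubit gX 0 ∈ tetrad k ∧ onQubit gZ 0 * onQubit gX 1 ∈ tetrad k ∧
      onQubit gZ 0 * (onQubit gX 1 * onQubit gZ 1) ∈ tetrad k ∧
      onQubit gZ 0 * onQubit gZ 1 ∈ tetrad k := by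
  refine ⟨?_, ?_, ?_, ?_⟩ <;>
    exact ⟨1, one_mem _, _, by simp, one_mul _⟩

theorem omegaI_pow_mul_mem_tetrad {k : ℕ} {P : UN (k + 2)} (hP : P ∈ tetrad k) (m : ℕ) :
    omegaI (k + 2) ^ m * P ∈ tetrad k := by
  obtain ⟨w, hw, Q, hQ, rfl⟩ := hP
  exact ⟨_, mul_mem (Subgroup.npow_mem_zpowers _ m) hw, Q, hQ, mul_assoc _ _ _⟩

theorem mem_conjStabilizer_tetrad {k : ℕ} {g : ProjCliff (k + 2)}
    (hX : act g (onQubit gX 0) ∈ tetrad k)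
    (hZX : act g (onQubit gZ 0) * act g (onQubit gX 1) ∈ tetrad k)
    (hZXZ : act g (onQubit gZ 0) * (act g (onQubit gX 1) * act g (onQubit gZ 1)) ∈ tetrad k)
    (hZZ : act g (onQubit gZ 0) * act g (onQubit gZ 1) ∈ tetrad k) :
    g ∈ conjStabilizer (tetrad k) := by
  refine (MulAction.mem_stabilizer_set_iff_smul_set_subset (finite_tetrad k)).2 ?_
  rintro _ ⟨_, ⟨_, ⟨r, rfl⟩, Q, hQ, rfl⟩, rfl⟩
  have hQ' : act g Q ∈ tetrad k := by
    rcases hQ with rfl | rfl | rfl | rfl <;> simpa only [map_mul]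
  obtain ⟨w, hw, R, hR, hwR⟩ := hQ'
  refine ⟨omegaI _ ^ r * w, mul_mem (Subgroup.zpow_mem_zpowers _ r) hw, R, hR, ?_⟩
  change omegaI _ ^ r * w * R = act g (omegaI _ ^ r * Q)
  rw [map_mul, map_zpow, act_omegaI, mul_assoc]
  exact congrArg _ hwR

theorem h_one_mem_conjStabilizer_tetrad (k : ℕ) :
    h (1 : Fin (k + 2)) ∈ conjStabilizer (tetrad k) := by
  obtain ⟨hX, hZX, hZXZ, hZZ⟩ := mem_tetrad k
  have h10 : (1 : Fin (k + 2)) ≠ 0 := one_ne_zero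
  refine mem_conjStabilizer_tetrad ?_ ?_ ?_ ?_ <;>
    simp only [act_h_gX, act_h_gZ, if_neg h10, if_pos]
  · exact hX
  · exact hZZ
  · rw [onQubit_gZ_mul_gX, (omegaI_pow_commute _ 4).left_comm]
    exact omegaI_pow_mul_mem_tetrad hZXZ 4
  · exact hZX

theorem s_one_mem_conjStabilizer_tetrad (k : ℕ) :
    s (1 : Fin (k + 2)) ∈ conjStabilizer (tetrad k) := by
  obtain ⟨hX, hZX, hZXZ, hZZ⟩ := mem_tetrad k
  have h10 : (1 : Fin (k + 2)) ≠ 0 := one_ne_zero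
  refine mem_conjStabilizer_tetrad ?_ ?_ ?_ ?_ <;>
    simp only [act_s_gX, act_s_gZ, if_neg h10, if_pos]
  · exact hX
  · rw [(omegaI_pow_commute _ 2).left_comm]
    exact omegaI_pow_mul_mem_tetrad hZXZ 2
  · rw [mul_assoc, mul_assoc, onQubit_gZ_mul_self, mul_one, (omegaI_pow_commute _ 2).left_comm]
    exact omegaI_pow_mul_mem_tetrad hZX 2
  · exact hZZ

theorem h_mul_s_sq_mul_h_mem_conjStabilizer_tetrad (k : ℕ) :
    h (0 : Fin (k + 2)) * s 0 ^ 2 * h 0 ∈ conjStabilizer (tetrad k) := by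
  obtain ⟨hX, hZX, hZXZ, hZZ⟩ := mem_tetrad k
  have h01 : (0 : Fin (k + 2)) ≠ 1 := zero_ne_one
  refine mem_conjStabilizer_tetrad ?_ ?_ ?_ ?_ <;>
    simp only [act_mul, act_h_gX, act_h_gZ, act_s_sq_gX, act_s_sq_gZ, if_neg h01, if_pos,
      map_mul, map_pow, act_omegaI, mul_assoc]
  · exact hX
  · exact omegaI_pow_mul_mem_tetrad hZX 4
  · exact omegaI_pow_mul_mem_tetrad hZXZ 4
  · exact omegaI_pow_mul_mem_tetrad hZZ 4

theorem elemM_mem_conjStabilizer_tetrad (k : ℕ) : elemM k ∈ conjStabilizer (tetrad k) := by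
  obtain ⟨hX, hZX, hZXZ, hZZ⟩ := mem_tetrad k
  have hXX : Commute (onQubit gX 1) (onQubit gX 0 : UN (k + 2)) := onQubit_commute _ _ one_ne_zero
  have hXZ : Commute (onQubit gX 1) (onQubit gZ 0 : UN (k + 2)) := onQubit_commute _ _ one_ne_zero
  have hcancel (i : Fin (k + 2)) (U : UN (k + 2)) : onQubit gX i * (onQubit gX i * U) = U := by
    rw [← mul_assoc, onQubit_gX_mul_self, one_mul]
  refine mem_conjStabilizer_tetrad ?_ ?_ ?_ ?_ <;>
    simp only [act_elemM_gX_zero, act_elemM_gZ_zero, act_elemM_gX_one, act_elemM_gZ_one,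
      mul_assoc, hXX.eq, hXZ.eq, hXX.left_comm, hXZ.left_comm, hcancel, onQubit_gX_mul_self,
      mul_one]
  · exact hZX
  · exact omegaI_pow_mul_mem_tetrad hX 4
  · exact omegaI_pow_mul_mem_tetrad hZXZ 4
  · exact omegaI_pow_mul_mem_tetrad hZZ 4

theorem onQubit_gZ_zero_notMem_tetrad (k : ℕ) : onQubit gZ 0 ∉ tetrad k := by
  rintro ⟨w, ⟨r, rfl⟩, Q, hQ, hmul⟩
  have hcomm (V : UN (k + 2)) (hV : Commute (onQubit gZ 0) V) : Commute Q V := by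
    rw [eq_inv_mul_of_mul_eq hmul]
    exact ((Commute.zpow_left (omegaI_comm V).symm r).inv_left).mul_left hV
  have hcancel (U V : UN (k + 2)) (hV : Commute (onQubit gZ 0) V)
      (hUV : Commute (onQubit gZ 0 * U) V) : Commute U V := by
    simpa only [inv_mul_cancel_left] using hV.inv_left.mul_left hUV
  have hZX : Commute (onQubit gZ 0) (onQubit gX 1 : UN (k + 2)) := onQubit_commute _ _ zero_ne_one
  have hZZ : Commute (onQubit gZ 0) (onQubit gZ 1 : UN (k + 2)) := onQubit_commute _ _ zero_ne_one
  rcases hQ with rfl | rfl | rfl | rfl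
  · exact onQubit_gX_not_commute_gZ _ (hcomm _ (Commute.refl _))
  · exact onQubit_gX_not_commute_gZ _ (hcancel _ _ hZZ (hcomm _ hZZ))
  · have hXZ := (hcancel _ _ hZZ (hcomm _ hZZ)).mul_left (Commute.refl (onQubit gZ 1)).inv_left
    exact onQubit_gX_not_commute_gZ _ (by rwa [mul_inv_cancel_right] at hXZ)
  · exact onQubit_gX_not_commute_gZ _ (hcancel _ _ hZX (hcomm _ hZX)).symm

theorem h_zero_notMem_conjStabilizer_tetrad (k : ℕ) :
    h (0 : Fin (k + 2)) ∉ conjStabilizer (tetrad k) := fun hmem =>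
  onQubit_gZ_zero_notMem_tetrad k <| by
    have hX := Set.smul_mem_smul_set (a := act (h (0 : Fin (k + 2)))) (mem_tetrad k).1
    rwa [mem_conjStabilizer.1 hmem, MulAut.smul_def, act_h_gX, if_pos rfl] at hX

/-! ### `F n` as a subgroup of `IN n` -/

theorem omega_eq : omega = ((1 / Real.sqrt 2 : ℝ) : ℂ) * (1 + Complex.I) := by
  have harg : (Real.pi * Complex.I / 4 : ℂ) = ((Real.pi / 4 : ℝ) : ℂ) * Complex.I := by
    push_cast
    ring
  rw [omega, harg, Complex.exp_mul_I, ← Complex.ofReal_cos, ← Complex.ofReal_sin,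
    Real.cos_pi_div_four, Real.sin_pi_div_four, Real.sqrt_div_self']
  ring

theorem coe_gS_mul_gH_word : ((gS * gH * gS * gH * gS : U2) : Matrix (Fin 2) (Fin 2) ℂ) =
    omega • (gH : Matrix (Fin 2) (Fin 2) ℂ) := by
  have hword : matS * !![1, 1; 1, -1] * matS * !![1, 1; 1, -1] * matS =
      (1 + Complex.I) • !![1, 1; 1, -1] := by
    rw [matS, omega_sq]
    ext a b
    fin_cases a <;> fin_cases b <;> simp <;> grind [Complex.I_mul_I]
  change matS * matH * matS * matH * matS = omega • matH
  simp only [matH, Matrix.smul_mul, Matrix.mul_smul, hword, omega_eq, mul_smul]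
  rw [smul_comm (1 + Complex.I)]

theorem toProj_eq_of_eq_omegaI_mul {n : ℕ} {U V : Cliff n} (hUV : (U : UN n) = omegaI n * V) :
    toProj U = toProj V := by
  have hmul : U = V * ⟨omegaI n, omegaI_mem n⟩ := Subtype.ext (hUV.trans (omegaI_comm _).symm)
  rw [hmul]
  exact congrArg MulOpposite.op (QuotientGroup.mk_mul_of_mem V (Subgroup.mem_zpowers _))

theorem s_mul_h_word {n : ℕ} (i : Fin n) : s i * h i * s i * h i * s i = h i := by
  simp only [s, h, toProj_mul]
  refine toProj_eq_of_eq_omegaI_mul ?_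
  change onQubit gS i * (onQubit gH i * (onQubit gS i * (onQubit gH i * onQubit gS i))) = _
  simp only [onQubit_mul, ← mul_assoc]
  simpa using onQubit_eq_omegaI_pow_mul (m := 1) (coe_gS_mul_gH_word.trans (by rw [pow_one])) i

theorem s_pow_three_mul_h_word {n : ℕ} (i : Fin n) :
    s i ^ 3 * h i * s i * h i * s i = s i ^ 2 * h i := by
  rw [pow_succ]
  simpa only [mul_assoc] using congrArg (s i ^ 2 * ·) (s_mul_h_word i)

theorem conj_s_zero_sq_eq_s_sq_mul_s_sq (k : ℕ) :
    (h 0 * (elemM k * h 1))⁻¹ * s 0 ^ 2 * (h 0 * (elemM k * h 1)) =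
      (s 0 ^ 2 * s 1 ^ 2 : ProjCliff (k + 2)) := by
  have hact : act (h 0 * (elemM k * h 1) : ProjCliff (k + 2)) (onQubit gZ 0) =
      onQubit gZ 1 * onQubit gZ 0 := by
    rw [act_mul, act_mul, act_h_gZ, if_pos rfl, act_elemM_gX_zero, map_mul, act_h_gX, act_h_gZ,
      if_pos rfl, if_neg one_ne_zero]
  rw [s_sq, s_sq, toProj_mul]
  exact inv_mul_toProj_mul _ _ _ hact

theorem s_zero_sq_mem_F_two : s 0 ^ 2 ∈ F 2 := by
  have hh : h 1 ∈ F 2 := Subgroup.subset_closure (.inl rfl)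
  have hs : s 1 ∈ F 2 := Subgroup.subset_closure (.inr (.inl rfl))
  have hx : h 0 * s 0 ^ 2 * h 0 ∈ F 2 := Subgroup.subset_closure (.inr (.inr (.inl rfl)))
  have hM : elemM 0 ∈ F 2 := Subgroup.subset_closure (.inr (.inr (.inr rfl)))
  exact mem_of_conj_eq_mul (h_mul_self 0) hx (mul_mem hM hh) (pow_mem hs 2)
    (conj_s_zero_sq_eq_s_sq_mul_s_sq 0)

theorem IN_eq_F_sup_zpowers : ∀ n, IN (n + 1) = F (n + 1) ⊔ Subgroup.zpowers (h 0)
  | 0 => by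
    rw [IN, F, Subgroup.zpowers_eq_closure, ← Subgroup.closure_union, Set.union_singleton]
  | 1 => by
    rw [IN, F, Subgroup.zpowers_eq_closure, ← Subgroup.closure_union, Set.union_singleton]
  | k + 2 => by
    have hrange : {g | ∃ i : Fin (k + 3), g = h i} =
        insert (h 0) {g | ∃ i : Fin (k + 3), i ≠ 0 ∧ g = h i} := by
      ext g
      simp [Fin.exists_fin_succ, Fin.succ_ne_zero]
    rw [IN, F, hrange, Subgroup.zpowers_eq_closure, ← Subgroup.closure_union,
      Set.union_singleton (a := h 0), Set.insert_union, Set.insert_union, Set.insert_union]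

theorem h_zero_commute_cz {k : ℕ} {i : Fin (k + 1)} (hi : i ≠ 0) : Commute (h 0) (cz i) :=
  h_commute_cz (fun he => hi (Fin.castSucc_eq_zero_iff.1 he.symm)) i.succ_ne_zero.symm

theorem h_zero_mem_normalizer_F :
    ∀ n, h 0 ∈ Subgroup.normalizer (F (n + 1) : Set (ProjCliff (n + 1)))
  | 0 => by
    refine mem_normalizer_closure (h_mul_self 0) ?_
    rintro _ rfl
    rw [s_pow_three_mul_h_word, mul_mul_mul_eq_inv (h_mul_self 0) (s_sq_mul_self 0)]
    exact inv_mem (Subgroup.subset_closure rfl)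
  | 1 => by
    have h01 : (0 : Fin 2) ≠ 1 := zero_ne_one
    refine mem_normalizer_closure (h_mul_self 0) ?_
    rintro _ (rfl | rfl | rfl | rfl)
    · rw [mul_mul_eq_of_commute (h_mul_self 0) (h_commute_h h01)]
      exact Subgroup.subset_closure (.inl rfl)
    · rw [mul_mul_eq_of_commute (h_mul_self 0) (h_commute_s h01)]
      exact Subgroup.subset_closure (.inr (.inl rfl))
    · rw [mul_mul_mul_mul_cancel (h_mul_self 0)]
      exact s_zero_sq_mem_F_two
    · rw [h_zero_mul_elemM_mul_h_zero]
      exact inv_mem (Subgroup.subset_closure (.inr (.inr (.inr rfl))))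
  | k + 2 => by
    refine mem_normalizer_closure (h_mul_self 0) ?_
    rintro _ (((⟨i, hi, rfl⟩ | ⟨i, hi, rfl⟩) | rfl) | ⟨i, hi, rfl⟩)
    · rw [mul_mul_eq_of_commute (h_mul_self 0) (h_commute_h hi.symm)]
      exact Subgroup.subset_closure (.inl (.inl (.inl ⟨i, hi, rfl⟩)))
    · rw [mul_mul_eq_of_commute (h_mul_self 0) (h_commute_s hi.symm)]
      exact Subgroup.subset_closure (.inl (.inl (.inr ⟨i, hi, rfl⟩)))
    · rw [h_zero_mul_elemM_mul_h_zero]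
      exact inv_mem (Subgroup.subset_closure (.inl (.inr rfl)))
    · rw [mul_mul_eq_of_commute (h_mul_self 0) (h_zero_commute_cz hi)]
      exact Subgroup.subset_closure (.inr ⟨i, hi, rfl⟩)

theorem F_one_le_conjStabilizer : F 1 ≤ conjStabilizer (onQubit gX 0 * onQubit gZ 0 : UN 1) := by
  rw [F, Subgroup.closure_le]
  rintro _ rfl
  rw [s_pow_three_mul_h_word, SetLike.mem_coe, mem_conjStabilizer, MulAut.smul_def, act_mul]
  simp only [map_mul, act_s_sq_gX, act_s_sq_gZ, act_h_gX, act_h_gZ, if_pos, map_pow, act_omegaI]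
  rw [mul_assoc, onQubit_gZ_mul_gX, ← mul_assoc, omegaI_pow_four_mul_self, one_mul]

theorem F_two_le_conjStabilizer : F 2 ≤ conjStabilizer (tetrad 0) := by
  rw [F, Subgroup.closure_le]
  rintro _ (rfl | rfl | rfl | rfl)
  exacts [h_one_mem_conjStabilizer_tetrad 0, s_one_mem_conjStabilizer_tetrad 0,
    h_mul_s_sq_mul_h_mem_conjStabilizer_tetrad 0, elemM_mem_conjStabilizer_tetrad 0]

theorem F_add_three_le_conjStabilizer (k : ℕ) :
    F (k + 3) ≤ conjStabilizer (onQubit gX 0 * onQubit gZ 0 : UN (k + 3)) := by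
  rw [F, Subgroup.closure_le]
  rintro _ (((⟨i, hi, rfl⟩ | ⟨i, hi, rfl⟩) | rfl) | ⟨i, hi, rfl⟩) <;>
    rw [SetLike.mem_coe]
  · rw [mem_conjStabilizer, MulAut.smul_def, map_mul, act_h_gX, act_h_gZ, if_neg hi, if_neg hi]
  · rw [mem_conjStabilizer, MulAut.smul_def, map_mul, act_s_gX, act_s_gZ, if_neg hi]
  · exact elemM_mem_conjStabilizer_gX_mul_gZ (k + 1)
  · have hcast : 0 ≠ i.castSucc := fun he => hi (Fin.castSucc_eq_zero_iff.1 he.symm)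
    rw [mem_conjStabilizer, MulAut.smul_def, map_mul, act_cz_gX, act_cz_gZ, if_neg hcast,
      if_neg i.succ_ne_zero.symm]

theorem h_zero_notMem_F : ∀ n, h 0 ∉ F (n + 1)
  | 0 => fun hmem => h_notMem_conjStabilizer_gX_mul_gZ 0 (F_one_le_conjStabilizer hmem)
  | 1 => fun hmem => h_zero_notMem_conjStabilizer_tetrad 0 (F_two_le_conjStabilizer hmem)
  | k + 2 => fun hmem =>
    h_notMem_conjStabilizer_gX_mul_gZ 0 (F_add_three_le_conjStabilizer k hmem)

theorem F_relIndex_IN (n : ℕ) : (F (n + 1)).relIndex (IN (n + 1)) = 2 := by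
  have hsq : h 0 ^ 2 ∈ F (n + 1) := by
    rw [pow_two, h_mul_self]
    exact one_mem _
  rw [IN_eq_F_sup_zpowers]
  exact relIndex_sup_zpowers_eq_two (h_zero_mem_normalizer_F n) hsq (h_zero_notMem_F n)

end

end QubitClifford

theorem mainTheorem7 (n : ℕ) (hn : 1 ≤ n) :
    QubitClifford.F n ≤ QubitClifford.IN n ∧
      ((QubitClifford.F n).subgroupOf (QubitClifford.IN n)).Normal ∧
      Finite (QubitClifford.IN n) ∧
      2 * Nat.card (QubitClifford.F n) = Nat.card (QubitClifford.IN n) := by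
  obtain ⟨k, rfl⟩ := Nat.exists_eq_add_of_le' hn
  have hle : QubitClifford.F (k + 1) ≤ QubitClifford.IN (k + 1) :=
    (QubitClifford.IN_eq_F_sup_zpowers k).symm ▸ le_sup_left
  have hindex := QubitClifford.F_relIndex_IN k
  refine ⟨hle, Subgroup.normal_of_index_eq_two hindex, QubitClifford.finite_IN (k + 1), ?_⟩
  have hcard := Subgroup.relIndex_mul_relIndex ⊥ _ _ bot_le hle
  rw [Subgroup.relIndex_bot_left, Subgroup.relIndex_bot_left, hindex] at hcard
  exact (mul_comm _ _).trans hcard
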